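/- An algebraic circuit over $\mathbb{C}$ is a finite directed acyclic graph whose nodes are leaves labelled by variables or by constants, product nodes, and sum nodes (of arbitrary fan-in; wires into sum nodes carry constants, so that sum nodes compute linear combinations of their children), with one node designated as the root; the circuit computes the polynomial computed at its root. Its size is the number of its nodes plus the number of its wires, and $S(f)$ denotes the least size of an algebraic circuit computing $f$. For $1\le i\le n$ let $e_i$, $h_i$ and $p_i$ be the elementary, complete homogeneous and power-sum symmetric polynomials of degree $i$ in $x_1,\dots,x_n$. **Theorem.** There are absolute constants $K,c\in\mathbb{N}$ such that for every $n\ge 0$ and every symmetric polynomial $f_{sym}\in\mathbb{C}[x_1,\dots,x_n]$ there are unique polynomials $f_E,f_H,f_P\in\mathbb{C}[x_1,\dots,x_n]$ with $$f_{sym}=f_E(e_1,\dots,e_n)=f_H(h_1,\dots,h_n)=f_P(p_1,\dots,p_n),$$ and, with $d=\deg f_E$ the total degree of $f_E$ (where $\deg 0=0$), each of $S(f_E)$, $S(f_H)$, $S(f_P)$ is at most $$K\,d^2\,S(f_{sym})+c\,(n+d+1)^c .$$ -/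

import Mathlib

/-- A node of an algebraic circuit with variables `σ` and constants `k`, whose children are among
`m` earlier nodes. Fan-in is unbounded. The wires entering a `sum` node carry constants,
so that it computes a linear combination of its children. The lists allow parallel wires.
(A `sum` or `prod` node without children is worth `0` or `1`, the same as a constant leaf
of the same size.) -/
inductive AlgGate (k σ : Type*) (m : ℕ) where
  | var (i : σ) : AlgGate k σ m
  | const (c : k) : AlgGate k σ m
  | sum (l : List (k × Fin m)) : AlgGate k σ m
  | prod (l : List (Fin m)) : AlgGate k σ m

/-- An algebraic circuit with `m` nodes: a directed acyclic graph, given with a topological order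
of its nodes. The node appended last has its children among the previous ones. -/
inductive AlgCircuit (k σ : Type*) : ℕ → Type _ where
  | nil : AlgCircuit k σ 0
  | snoc {m : ℕ} (C : AlgCircuit k σ m) (g : AlgGate k σ m) : AlgCircuit k σ (m + 1)

/-- The number of wires entering a node. -/
def AlgGate.fanIn {k σ : Type*} {m : ℕ} : AlgGate k σ m → ℕ
  | .var _ => 0
  | .const _ => 0
  | .sum l => l.length
  | .prod l => l.length

/-- The polynomial computed at a node from the polynomials computed at the earlier nodes. -/
noncomputable def AlgGate.eval {k σ : Type*} [CommSemiring k] {m : ℕ}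
    (v : Fin m → MvPolynomial σ k) : AlgGate k σ m → MvPolynomial σ k
  | .var i => MvPolynomial.X i
  | .const c => MvPolynomial.C c
  | .sum l => (l.map fun a => MvPolynomial.C a.1 * v a.2).sum
  | .prod l => (l.map v).prod

/-- The size of a circuit: the number of its nodes plus the number of its wires. -/
def AlgCircuit.size {k σ : Type*} : {m : ℕ} → AlgCircuit k σ m → ℕ
  | _, .nil => 0
  | _, .snoc C g => C.size + (1 + g.fanIn)

/-- The polynomial computed at each node of a circuit. -/
noncomputable def AlgCircuit.value {k σ : Type*} [CommSemiring k] :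
    {m : ℕ} → AlgCircuit k σ m → Fin m → MvPolynomial σ k
  | _, .nil => Fin.elim0
  | _, .snoc C g => Fin.snoc (α := fun _ => MvPolynomial σ k) C.value (g.eval C.value)

/-- `HasCircuitOfSize f s`: some algebraic circuit of size `s` computes `f` at one of its nodes,
its root. (Nodes from which the root cannot be reached are not forbidden; removing them makes
the root the unique sink and only decreases the size.) -/
def HasCircuitOfSize {k σ : Type*} [CommSemiring k] (f : MvPolynomial σ k) (s : ℕ) : Prop :=
  ∃ (m : ℕ) (C : AlgCircuit k σ m) (r : Fin m), C.value r = f ∧ C.size = s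

/-- Every circuit can be extended to one that also computes a given polynomial. -/
theorem AlgCircuit.exists_extension {k σ : Type*} [CommSemiring k] (f : MvPolynomial σ k) :
    ∀ (m : ℕ) (C : AlgCircuit k σ m), ∃ (m' : ℕ) (D : AlgCircuit k σ m') (e : Fin m → Fin m'),
      (∀ i, D.value (e i) = C.value i) ∧ ∃ r, D.value r = f := by
  induction f using MvPolynomial.induction_on with
  | C a =>
    intro m C
    refine ⟨m + 1, C.snoc (.const a), Fin.castSucc, ?_, Fin.last m, ?_⟩ <;>
      simp [AlgCircuit.value, AlgGate.eval]
  | add p q hp hq =>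
    intro m C
    obtain ⟨m₁, D₁, e₁, h₁, r₁, hr₁⟩ := hp m C
    obtain ⟨m₂, D₂, e₂, h₂, r₂, hr₂⟩ := hq m₁ D₁
    refine ⟨m₂ + 1, D₂.snoc (.sum [(1, e₂ r₁), (1, r₂)]), fun i => (e₂ (e₁ i)).castSucc, ?_,
      Fin.last m₂, ?_⟩ <;> simp [AlgCircuit.value, AlgGate.eval, h₁, h₂, hr₁, hr₂]
  | mul_X p i hp =>
    intro m C
    obtain ⟨m₁, D₁, e₁, h₁, r₁, hr₁⟩ := hp m C
    refine ⟨m₁ + 1 + 1, (D₁.snoc (.var i)).snoc (.prod [r₁.castSucc, Fin.last m₁]),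
      fun i => (e₁ i).castSucc.castSucc, ?_, Fin.last _, ?_⟩ <;>
      simp [AlgCircuit.value, AlgGate.eval, h₁, hr₁]

/-- Every polynomial is computed by some circuit. -/
theorem exists_hasCircuitOfSize {k σ : Type*} [CommSemiring k] (f : MvPolynomial σ k) :
    ∃ s, HasCircuitOfSize f s := by
  obtain ⟨m, D, _, _, r, hr⟩ := AlgCircuit.exists_extension f 0 .nil
  exact ⟨D.size, m, D, r, hr, rfl⟩

open Classical in
/-- The circuit complexity `S(f)`: the least size of an algebraic circuit computing `f`. -/
noncomputable def circuitSize {k σ : Type*} [CommSemiring k] (f : MvPolynomial σ k) : ℕ :=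
  Nat.find (exists_hasCircuitOfSize f)

/-! Write f = g(e_1, …, e_n), with d the total degree of g, and let w be any tuple of polynomials
with small circuits. To compute g(w) from a circuit for f, one needs arguments z at which the
elementary symmetric functions take the values w, that is, the roots of the polynomial with
coefficients ±w_i. These are algebraic functions, so they are replaced by truncated power series in
an auxiliary variable t.

Fix distinct scalars a_i and move along the line s(t) = e(a) + t(w - e(a)). At t = 0 the roots are
the a_i, which are simple. Hence d steps of Newton's iteration, with slope frozen at its value for t
= 0, give polynomials z_i(t) that are roots modulo t^(d+1) (`aeval_newtonRoot`). In the quotient by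
t^(d+1) the differences of the z_i are units, so the elementary symmetric functions of z are exactly
s, and f(z) ≡ g(s) (`dvd_aeval_newtonRoot_sub`). As s is affine in t, g(s) has degree at most d in
t. So g(w), its value at t = 1, is the sum of the coefficients of f(z) up to degree d.

Circuits are run on truncated polynomials in t by keeping d + 1 coefficients for each node
(`Derives.coeffSet_circuit`). This costs a factor of order (d + 1)^2, the source of d^2 S(f) in the
bound; the rest is polynomial in n and d (`circuitSize_aeval_le`).

Taking w = X gives f_E. For f_H and f_P, the recursions expressing e_i through the h_j or the p_j
give e_i = E_i(h) or E_i(p) with small circuits for E_i, and f_H or f_P is f_E(E). Uniqueness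
follows from the fundamental theorem on symmetric polynomials and the injectivity of surjective
endomorphisms of a Noetherian ring (`eq_aeval_iff_of_esymm_eq`). -/

/-- `Derives S T c`: every circuit computing the polynomials in `S` can be extended, at the cost
of `c` additional nodes and wires, to a circuit that also computes the polynomials in `T`. -/
def Derives {k σ : Type*} [CommSemiring k] (S T : Set (MvPolynomial σ k)) (c : ℕ) : Prop :=
  ∀ (m : ℕ) (C : AlgCircuit k σ m), S ⊆ Set.range C.value →
    ∃ (m' : ℕ) (D : AlgCircuit k σ m'), Set.range C.value ⊆ Set.range D.value ∧
      T ⊆ Set.range D.value ∧ D.size ≤ C.size + c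

/-! ### Calculus of circuit extensions and their costs -/

namespace Derives

variable {k σ : Type*} [CommSemiring k] {S S' T T' U : Set (MvPolynomial σ k)} {c c' : ℕ}

theorem mono (h : Derives S T c) (hS : S ⊆ S') (hT : T' ⊆ T) (hc : c ≤ c') :
    Derives S' T' c' := by
  intro m C hC
  obtain ⟨m', D, h₁, h₂, h₃⟩ := h m C (hS.trans hC)
  exact ⟨m', D, h₁, hT.trans h₂, h₃.trans (by lia)⟩

theorem of_subset (h : T ⊆ S) (c : ℕ) : Derives S T c :=
  fun m C hC => ⟨m, C, subset_rfl, h.trans hC, by lia⟩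

/-- An extension keeps all values computed before, so intermediate results are shared and costs
simply add. -/
theorem trans (h : Derives S T c) (h' : Derives (S ∪ T) U c') : Derives S (T ∪ U) (c + c') := by
  intro m C hC
  obtain ⟨m₁, D₁, h₁, h₂, h₃⟩ := h m C hC
  obtain ⟨m₂, D₂, h₄, h₅, h₆⟩ := h' m₁ D₁ (Set.union_subset (hC.trans h₁) h₂)
  exact ⟨m₂, D₂, h₁.trans h₄, Set.union_subset (h₂.trans h₄) h₅, by lia⟩

theorem union (h : Derives S T c) (h' : Derives S U c') : Derives S (T ∪ U) (c + c') :=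
  h.trans (h'.mono Set.subset_union_left subset_rfl le_rfl)

theorem biUnion {ι : Type*} (s : Finset ι) (T : ι → Set (MvPolynomial σ k))
    (h : ∀ i ∈ s, Derives S (T i) c) : Derives S (⋃ i ∈ s, T i) (s.card * c) := by
  classical
  induction s using Finset.induction_on with
  | empty => exact of_subset (by simp) _
  | insert a s ha ih =>
    rw [Finset.set_biUnion_insert, Finset.card_insert_of_notMem ha]
    exact ((h a (Finset.mem_insert_self a s)).union
      (ih fun i hi => h i (Finset.mem_insert_of_mem hi))).mono subset_rfl subset_rfl (by lia)

theorem iUnion {ι : Type*} [Fintype ι] (T : ι → Set (MvPolynomial σ k))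
    (h : ∀ i, Derives S (T i) c) : Derives S (⋃ i, T i) (Fintype.card ι * c) := by
  simpa using biUnion Finset.univ T fun i _ => h i

theorem range {ι : Type*} [Fintype ι] (p : ι → MvPolynomial σ k)
    (h : ∀ i, Derives S {p i} c) : Derives S (Set.range p) (Fintype.card ι * c) := by
  simpa using iUnion (fun i => {p i}) h

theorem gate {p : MvPolynomial σ k}
    (h : ∀ (m : ℕ) (C : AlgCircuit k σ m), S ⊆ Set.range C.value →
      ∃ g : AlgGate k σ m, g.eval C.value = p ∧ 1 + g.fanIn ≤ c) : Derives S {p} c := by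
  intro m C hC
  obtain ⟨g, hg, hc⟩ := h m C hC
  refine ⟨m + 1, C.snoc g, ?_, ?_, by simpa [AlgCircuit.size] using hc⟩
  · rintro _ ⟨i, rfl⟩
    exact ⟨i.castSucc, by simp [AlgCircuit.value]⟩
  · rintro _ rfl
    exact ⟨Fin.last m, by simp [AlgCircuit.value, hg]⟩

theorem X (S : Set (MvPolynomial σ k)) (i : σ) : Derives S {MvPolynomial.X i} 1 :=
  gate fun _ _ _ => ⟨.var i, rfl, le_rfl⟩

theorem C (S : Set (MvPolynomial σ k)) (a : k) : Derives S {MvPolynomial.C a} 1 :=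
  gate fun _ _ _ => ⟨.const a, rfl, le_rfl⟩

theorem sum (l : List (k × MvPolynomial σ k)) (h : ∀ a ∈ l, a.2 ∈ S) :
    Derives S {(l.map fun a => MvPolynomial.C a.1 * a.2).sum} (1 + l.length) := by
  refine gate fun m C hC => ?_
  have : l ∈ Set.range (List.map (Prod.map id C.value)) := by
    rw [Set.range_list_map]
    intro a ha
    obtain ⟨r, hr⟩ := hC (h a ha)
    exact ⟨(a.1, r), by simp [hr]⟩
  obtain ⟨l', rfl⟩ := this
  exact ⟨.sum l', by simp [AlgGate.eval, Function.comp_def], by simp [AlgGate.fanIn]⟩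

theorem prod (l : List (MvPolynomial σ k)) (h : ∀ p ∈ l, p ∈ S) :
    Derives S {l.prod} (1 + l.length) := by
  refine gate fun m C hC => ?_
  have : l ∈ Set.range (List.map C.value) := by
    rw [Set.range_list_map]
    exact fun p hp => hC (h p hp)
  obtain ⟨l', rfl⟩ := this
  exact ⟨.prod l', by simp [AlgGate.eval], by simp [AlgGate.fanIn]⟩

theorem finset_sum {ι : Type*} (s : Finset ι) (a : ι → k) (p : ι → MvPolynomial σ k)
    (h : ∀ i ∈ s, p i ∈ S) :
    Derives S {∑ i ∈ s, MvPolynomial.C (a i) * p i} (1 + s.card) := by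
  have := sum (S := S) (s.toList.map fun i => (a i, p i)) (by simpa using h)
  simpa [Function.comp_def] using this

theorem mul {p q : MvPolynomial σ k} (hp : p ∈ S) (hq : q ∈ S) : Derives S {p * q} 3 := by
  simpa using prod (S := S) [p, q] (by simp [hp, hq])

/-- A linear combination of products of two polynomials. -/
theorem finset_sum_mul {ι : Type*} (s : Finset ι) (a : ι → k) (p q : ι → MvPolynomial σ k)
    (hp : ∀ i ∈ s, p i ∈ S) (hq : ∀ i ∈ s, q i ∈ S) :
    Derives S {∑ i ∈ s, MvPolynomial.C (a i) * (p i * q i)} (1 + 4 * s.card) := by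
  have h₁ := biUnion s (fun i => {p i * q i}) fun i hi => mul (hp i hi) (hq i hi)
  have h₂ := finset_sum (S := S ∪ ⋃ i ∈ s, {p i * q i}) s a (fun i => p i * q i) fun i hi =>
    Or.inr (Set.mem_biUnion (s := (s : Set ι)) hi rfl)
  exact (h₁.trans h₂).mono subset_rfl Set.subset_union_right (by lia)

theorem exists_circuit (h : Derives ∅ T c) :
    ∃ (m : ℕ) (D : AlgCircuit k σ m), T ⊆ Set.range D.value ∧ D.size ≤ c := by
  obtain ⟨m, D, -, h₁, h₂⟩ := h 0 .nil (Set.empty_subset _)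
  exact ⟨m, D, h₁, by simpa [AlgCircuit.size] using h₂⟩

theorem circuitSize_le {p : MvPolynomial σ k} (h : Derives ∅ {p} c) : circuitSize p ≤ c := by
  classical
  obtain ⟨m, D, h₁, h₂⟩ := h.exists_circuit
  obtain ⟨r, hr⟩ := h₁ rfl
  refine le_trans ?_ h₂
  unfold circuitSize
  exact Nat.find_min' _ ⟨m, D, r, hr, rfl⟩

end Derives

theorem exists_circuit_size_eq_circuitSize {k σ : Type*} [CommSemiring k]
    (f : MvPolynomial σ k) :
    ∃ (m : ℕ) (C : AlgCircuit k σ m) (r : Fin m), C.value r = f ∧ C.size = circuitSize f := by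
  classical
  unfold circuitSize
  exact Nat.find_spec (exists_hasCircuitOfSize f)

/-! ### Circuits over truncated polynomials in an auxiliary variable -/

/-- The coefficients of `q` up to degree `d`. -/
def coeffSet {A : Type*} [Semiring A] (d : ℕ) (q : Polynomial A) : Set A :=
  q.coeff '' Set.Iic d

theorem coeff_mem_coeffSet {A : Type*} [Semiring A] {d j : ℕ} (q : Polynomial A) (h : j ≤ d) :
    q.coeff j ∈ coeffSet d q := ⟨j, h, rfl⟩

theorem Derives.coeffSet_of_coeff {k σ : Type*} [CommSemiring k] {S : Set (MvPolynomial σ k)} {d c : ℕ}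
    {q : Polynomial (MvPolynomial σ k)} (h : ∀ j ≤ d, Derives S {q.coeff j} c) :
    Derives S (coeffSet d q) ((d + 1) * c) := by
  refine (Derives.biUnion (Finset.range (d + 1)) (fun j => {q.coeff j}) fun j hj => h j ?_).mono
    subset_rfl ?_ (by simp)
  · exact Nat.lt_succ_iff.1 (Finset.mem_range.1 hj)
  · rintro _ ⟨j, hj, rfl⟩
    exact Set.mem_biUnion (s := (Finset.range (d + 1) : Set ℕ)) (by simpa [Nat.lt_succ_iff] using hj)
      rfl

/-- Each of the d + 1 coefficients is a convolution of at most d + 1 products, at cost at most 1 +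
4(d + 1), and involves no coefficient of index above d. -/
theorem Derives.coeffSet_mul {k σ : Type*} [CommSemiring k] {S : Set (MvPolynomial σ k)} {d : ℕ}
    {p q : Polynomial (MvPolynomial σ k)} (hp : coeffSet d p ⊆ S)
    (hq : coeffSet d q ⊆ S) :
    Derives S (coeffSet d (p * q)) (5 * (d + 1) ^ 2) := by
  refine (Derives.coeffSet_of_coeff (c := 5 * (d + 1)) fun j hj => ?_).mono subset_rfl subset_rfl
    (by nlinarith)
  have := Derives.finset_sum_mul (S := S) (Finset.HasAntidiagonal.antidiagonal j) (fun _ => 1)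
    (fun a => p.coeff a.1) (fun a => q.coeff a.2)
    (fun a ha => hp (coeff_mem_coeffSet p (by have := Finset.HasAntidiagonal.mem_antidiagonal.1 ha; lia)))
    (fun a ha => hq (coeff_mem_coeffSet q (by have := Finset.HasAntidiagonal.mem_antidiagonal.1 ha; lia)))
  rw [Polynomial.coeff_mul]
  exact this.mono subset_rfl (by simp) (by rw [Finset.Nat.card_antidiagonal]; lia)

/-- The factors are multiplied in one at a time, so the cost is linear in the fan-in, in keeping
with a size that counts wires. -/
theorem Derives.coeffSet_list_prod {k σ : Type*} [CommSemiring k] {S : Set (MvPolynomial σ k)}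
    {d : ℕ} (l : List (Polynomial (MvPolynomial σ k))) (h : ∀ p ∈ l, coeffSet d p ⊆ S) :
    Derives S (coeffSet d l.prod) (5 * (d + 1) ^ 2 * (1 + l.length)) := by
  induction l with
  | nil =>
    refine (Derives.coeffSet_of_coeff (c := 1) fun j hj => ?_).mono subset_rfl subset_rfl
      (by simp; nlinarith)
    rw [List.prod_nil, Polynomial.coeff_one]
    split_ifs
    · simpa using Derives.C S 1
    · simpa using Derives.C S 0
  | cons p l ih =>
    rw [List.prod_cons]
    have h₁ := ih fun q hq => h q (List.mem_cons_of_mem _ hq)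
    have h₂ := Derives.coeffSet_mul (S := S ∪ coeffSet d l.prod) (d := d) (p := p)
      (q := l.prod) ((h p List.mem_cons_self).trans Set.subset_union_left) Set.subset_union_right
    exact (h₁.trans h₂).mono subset_rfl Set.subset_union_right (by rw [List.length_cons]; lia)

theorem Derives.coeffSet_gate {k σ τ : Type*} [CommSemiring k] {S : Set (MvPolynomial σ k)}
    {d m : ℕ} (v : τ → Polynomial (MvPolynomial σ k)) (hv : ∀ i, coeffSet d (v i) ⊆ S)
    (g : AlgGate k τ m) (w : Fin m → MvPolynomial τ k)
    (hw : ∀ r, coeffSet d (MvPolynomial.aeval v (w r)) ⊆ S) :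
    Derives S (coeffSet d (MvPolynomial.aeval v (g.eval w)))
      (5 * (d + 1) ^ 2 * (1 + g.fanIn)) := by
  cases g with
  | var i => exact Derives.of_subset (by simpa [AlgGate.eval] using hv i) _
  | const a =>
    refine (Derives.coeffSet_of_coeff (c := 1) fun j hj => ?_).mono subset_rfl subset_rfl
      (by simp [AlgGate.fanIn]; nlinarith)
    have : MvPolynomial.aeval v ((AlgGate.const a : AlgGate k τ m).eval w) =
        Polynomial.C (MvPolynomial.C a) := by
      simp [AlgGate.eval, MvPolynomial.algebraMap_eq, Polynomial.algebraMap_eq,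
        IsScalarTower.algebraMap_apply k (MvPolynomial σ k) (Polynomial (MvPolynomial σ k))]
    rw [this, Polynomial.coeff_C]
    split_ifs
    · exact Derives.C S a
    · simpa using Derives.C S 0
  | sum l =>
    refine (Derives.coeffSet_of_coeff (c := 1 + l.length) fun j hj => ?_).mono subset_rfl subset_rfl
      (by simp only [AlgGate.fanIn]; gcongr; nlinarith)
    have := Derives.sum (S := S)
      (l.map fun a => (a.1, (MvPolynomial.aeval v (w a.2)).coeff j)) (by
        simp only [List.mem_map, forall_exists_index, and_imp]
        rintro _ a - rfl
        exact hw a.2 (coeff_mem_coeffSet _ hj))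
    convert this using 2
    · simp only [AlgGate.eval, map_list_sum, List.map_map, Function.comp_def, map_mul]
      rw [← Polynomial.lcoeff_apply, map_list_sum, List.map_map]
      congr 1
      refine List.map_congr_left fun a _ => ?_
      simp [IsScalarTower.algebraMap_apply k (MvPolynomial σ k) (Polynomial (MvPolynomial σ k)),
        Polynomial.algebraMap_eq, MvPolynomial.algebraMap_eq]
    · simp
  | prod l =>
    have := Derives.coeffSet_list_prod (S := S) (d := d)
      (l.map fun r => MvPolynomial.aeval v (w r)) (by simpa using fun r _ => hw r)
    simpa [AlgGate.eval, AlgGate.fanIn, map_list_prod, Function.comp_def] using this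

/-- Substituting polynomials in an auxiliary variable into a circuit and keeping the
coefficients of the result up to degree `d`. -/
theorem Derives.coeffSet_circuit {k σ τ : Type*} [CommSemiring k] {S : Set (MvPolynomial σ k)}
    {d : ℕ} (v : τ → Polynomial (MvPolynomial σ k)) (hv : ∀ i, coeffSet d (v i) ⊆ S)
    {m : ℕ} (C : AlgCircuit k τ m) :
    Derives S (⋃ r, coeffSet d (MvPolynomial.aeval v (C.value r)))
      (5 * (d + 1) ^ 2 * C.size) := by
  induction C with
  | nil => exact Derives.of_subset (by simp) _
  | @snoc m C g ih =>
    set T := ⋃ r, coeffSet d (MvPolynomial.aeval v (C.value r)) with hT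
    have h := Derives.coeffSet_gate (S := S ∪ T) v
      (fun i => (hv i).trans Set.subset_union_left) g C.value
      (fun r => (Set.subset_iUnion (fun r => coeffSet d (MvPolynomial.aeval v (C.value r))) r).trans
        Set.subset_union_right)
    refine (ih.trans h).mono subset_rfl (Set.iUnion_subset fun r => ?_)
      (by simp only [AlgCircuit.size]; lia)
    refine Fin.lastCases ?_ (fun r => ?_) r
    · simp [AlgCircuit.value]
    · simp only [AlgCircuit.value, Fin.snoc_castSucc]
      exact (Set.subset_iUnion (fun r => coeffSet d (MvPolynomial.aeval v (C.value r))) r).trans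
        Set.subset_union_left

/-! ### Polynomials with prescribed elementary symmetric functions -/

/-- The monic polynomial whose roots have the elementary symmetric functions `s 0, s 1, …`. -/
noncomputable def vietaPoly {B : Type*} [CommRing B] {n : ℕ} (s : Fin n → B) : Polynomial B :=
  Polynomial.X ^ n + ∑ i : Fin n,
    Polynomial.C ((-1) ^ ((i : ℕ) + 1) * s i) * Polynomial.X ^ (n - ((i : ℕ) + 1))

section vietaPoly

open Polynomial

variable {B : Type*} [CommRing B] {n : ℕ}

theorem vietaPoly_esymm (z : Fin n → B) :
    vietaPoly (fun i : Fin n => (Finset.univ.val.map z).esymm ((i : ℕ) + 1)) =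
      ∏ i, (X - C (z i)) := by
  have h := Multiset.prod_X_sub_X_eq_sum_esymm (Finset.univ.val.map z)
  rw [Multiset.map_map] at h
  have hc : Multiset.card (Finset.univ.val.map z) = n := by simp
  rw [hc, Finset.sum_range_succ'] at h
  unfold vietaPoly
  rw [Finset.prod, ← Function.comp_def (fun t => X - C t) z, h, add_comm]
  congr 1
  · rw [Finset.sum_range]
    simp [mul_assoc]
  · simp [Multiset.esymm]

theorem degree_vietaPoly_tail_lt (s : Fin n → B) :
    degree (∑ i : Fin n, C ((-1) ^ ((i : ℕ) + 1) * s i) * X ^ (n - ((i : ℕ) + 1))) < n := by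
  rw [degree_lt_iff_coeff_zero]
  intro m hm
  rw [finsetSum_coeff]
  refine Finset.sum_eq_zero fun i _ => ?_
  rw [coeff_C_mul_X_pow, if_neg]
  lia

theorem vietaPoly_monic (s : Fin n → B) : (vietaPoly s).Monic :=
  monic_X_pow_add (degree_vietaPoly_tail_lt s)

theorem natDegree_vietaPoly_le (s : Fin n → B) : (vietaPoly s).natDegree ≤ n := by
  refine natDegree_le_iff_degree_le.2 ((degree_add_le _ _).trans ?_)
  exact max_le (degree_X_pow_le n) (degree_vietaPoly_tail_lt s).le

theorem coeff_vietaPoly (s : Fin n → B) (i : Fin n) :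
    (vietaPoly s).coeff (n - ((i : ℕ) + 1)) = (-1) ^ ((i : ℕ) + 1) * s i := by
  rw [vietaPoly, coeff_add, coeff_X_pow, if_neg (by lia), zero_add, finsetSum_coeff,
    Finset.sum_eq_single i]
  · rw [coeff_C_mul_X_pow, if_pos rfl]
  · intro j _ hj
    rw [coeff_C_mul_X_pow, if_neg]
    intro h
    exact hj (Fin.ext (by lia))
  · simp

theorem vietaPoly_injective : Function.Injective (vietaPoly : (Fin n → B) → B[X]) := by
  intro s s' h
  funext i
  have h' := congrArg (fun p => coeff p (n - ((i : ℕ) + 1))) h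
  simp only [coeff_vietaPoly] at h'
  exact (((isUnit_one (M := B)).neg.pow _).mul_right_inj).1 h'

theorem eval_vietaPoly (s : Fin n → B) (x : B) :
    (vietaPoly s).eval x =
      x ^ n + ∑ i : Fin n, (-1) ^ ((i : ℕ) + 1) * s i * x ^ (n - ((i : ℕ) + 1)) := by
  simp [vietaPoly, eval_finsetSum]

theorem map_vietaPoly {B' : Type*} [CommRing B'] (φ : B →+* B') (s : Fin n → B) :
    (vietaPoly s).map φ = vietaPoly fun i => φ (s i) := by
  simp [vietaPoly, Polynomial.map_sum]

/-- If the values `z i` are roots of the polynomial with elementary symmetric functions `s` and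
their differences are units, then `s` are the elementary symmetric functions of `z`. -/
theorem esymm_eq_of_roots (s z : Fin n → B) (hz : Pairwise fun i j => IsUnit (z i - z j))
    (h : ∀ i, (vietaPoly s).eval (z i) = 0) (i : Fin n) :
    (Finset.univ.val.map z).esymm ((i : ℕ) + 1) = s i := by
  nontriviality B
  -- The ring need not be a domain: unit differences make the linear factors pairwise coprime, so
  -- their product divides, and monicity and degree then force equality.
  have hdvd : ∏ i, (X - C (z i)) ∣ vietaPoly s := by
    refine Finset.prod_dvd_of_coprime (fun i _ j _ hij => ?_) fun i _ => dvd_iff_isRoot.2 (h i)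
    exact isCoprime_X_sub_C_of_isUnit_sub (hz hij)
  have heq := eq_of_monic_of_dvd_of_natDegree_le
    (monic_prod_of_monic _ _ fun i _ => monic_X_sub_C (z i)) (vietaPoly_monic s) hdvd (by
      rw [natDegree_prod_of_monic _ _ fun i _ => monic_X_sub_C (z i)]
      simpa using natDegree_vietaPoly_le s)
  rw [← vietaPoly_esymm] at heq
  exact (congrFun (vietaPoly_injective heq) i).symm

theorem vietaPoly_add_mul (s r : Fin n → B) (t : B) :
    ∃ q : B[X], (vietaPoly fun i => s i + t * r i) = vietaPoly s + C t * q := by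
  refine ⟨∑ i : Fin n, C ((-1) ^ ((i : ℕ) + 1) * r i) * X ^ (n - ((i : ℕ) + 1)), ?_⟩
  rw [vietaPoly, vietaPoly, add_assoc, Finset.mul_sum, ← Finset.sum_add_distrib]
  congr 1
  refine Finset.sum_congr rfl fun i _ => ?_
  simp only [map_mul, map_add, map_pow, map_neg, map_one]
  ring

end vietaPoly

/-! ### Newton's iteration modulo powers of t -/

/-- One step of Newton's iteration with constant slope improves the precision by one. -/
theorem newton_step {B : Type*} [CommRing B] (P : Polynomial B) {t z a u : B} {m : ℕ} (hm : 1 ≤ m)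
    (hz : t ∣ z - a) (hu : t ∣ 1 - u * P.derivative.eval a) (h : t ^ m ∣ P.eval z) :
    t ∣ z - u * P.eval z - a ∧ t ^ (m + 1) ∣ P.eval (z - u * P.eval z) := by
  have ht : t ∣ P.eval z := (dvd_pow_self t (by lia)).trans h
  refine ⟨?_, ?_⟩
  · rw [sub_right_comm]
    exact dvd_sub hz (ht.mul_left u)
  -- Taylor expansion gives P(z - uP(z)) = P(z)(1 - uP'(z) + q u² P(z)), and t divides the second
  -- factor.
  · obtain ⟨q, hq⟩ := P.binomExpansion z (-(u * P.eval z))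
    have h₁ : t ∣ 1 - u * P.derivative.eval z := by
      have := (P.derivative.sub_dvd_eval_sub z a)
      have h₂ := dvd_sub hu ((hz.trans this).mul_left u)
      convert h₂ using 1
      ring
    have h₂ : t ∣ 1 - u * P.derivative.eval z + q * u ^ 2 * P.eval z := dvd_add h₁ (ht.mul_left _)
    have h₃ := mul_dvd_mul h h₂
    rw [← pow_succ] at h₃
    rw [sub_eq_add_neg, hq]
    convert h₃ using 1
    ring

/-- Modulo t^m, x is a unit plus a nilpotent. -/
theorem isUnit_quotient_mk_of_dvd_sub {B : Type*} [CommRing B] {t x y : B} (m : ℕ)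
    (hy : IsUnit y) (h : t ∣ x - y) : IsUnit (Ideal.Quotient.mk (Ideal.span {t ^ m}) x) := by
  have h₁ : IsNilpotent (Ideal.Quotient.mk (Ideal.span {t ^ m}) (x - y)) := by
    refine ⟨m, ?_⟩
    rw [← map_pow, Ideal.Quotient.eq_zero_iff_dvd]
    exact pow_dvd_pow_of_dvd h m
  have h₂ := h₁.isUnit_add_left_of_commute (hy.map (Ideal.Quotient.mk (Ideal.span {t ^ m})))
    (Commute.all _ _)
  rwa [← map_add, add_sub_cancel] at h₂

section newtonRoot

open MvPolynomial

variable {k : Type*} [Field k] {n : ℕ}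

/-- The elementary symmetric functions of `a`. -/
noncomputable def esymmValue (a : Fin n → k) (i : Fin n) : k :=
  (Finset.univ.val.map a).esymm ((i : ℕ) + 1)

/-- The approximations, by Newton's iteration with constant slope started at `a i`, of the `i`th
root of the polynomial whose coefficients are the variables. -/
noncomputable def newtonRoot (a : Fin n → k) (i : Fin n) : ℕ → MvPolynomial (Fin n) k
  | 0 => C (a i)
  | m + 1 => newtonRoot a i m -
      C (((vietaPoly (esymmValue a)).derivative.eval (a i))⁻¹) *
        (vietaPoly (X : Fin n → MvPolynomial (Fin n) k)).eval (newtonRoot a i m)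

/-- The roots a i are distinct, so the polynomial is separable. This makes the inverse slope in
`newtonRoot` a genuine inverse; being a scalar, it keeps the approximations polynomial in the
coefficients. -/
theorem derivative_vietaPoly_esymmValue_ne_zero {a : Fin n → k} (ha : Function.Injective a)
    (i : Fin n) : (vietaPoly (esymmValue a)).derivative.eval (a i) ≠ 0 := by
  unfold esymmValue
  rw [vietaPoly_esymm]
  refine (Polynomial.separable_prod_X_sub_C_iff.2 ha).eval₂_derivative_ne_zero (RingHom.id k) ?_
  simp [Polynomial.eval_prod, Finset.prod_eq_zero_iff, sub_eq_zero]

theorem eval_vietaPoly_esymmValue (a : Fin n → k) (i : Fin n) :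
    (vietaPoly (esymmValue a)).eval (a i) = 0 := by
  unfold esymmValue
  rw [vietaPoly_esymm]
  simp [Polynomial.eval_prod, Finset.prod_eq_zero_iff, sub_eq_zero]

variable {B : Type*} [CommRing B] [Algebra k B]

theorem aeval_newtonRoot_succ (a : Fin n → k) (i : Fin n) (m : ℕ) (s : Fin n → B) :
    aeval s (newtonRoot a i (m + 1)) = aeval s (newtonRoot a i m) -
      algebraMap k B (((vietaPoly (esymmValue a)).derivative.eval (a i))⁻¹) *
        (vietaPoly s).eval (aeval s (newtonRoot a i m)) := by
  simp [newtonRoot, eval_vietaPoly]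

theorem aeval_newtonRoot {a : Fin n → k} (ha : Function.Injective a) (i : Fin n) (t : B)
    (r : Fin n → B) (m : ℕ) :
    t ∣ aeval (fun j => algebraMap k B (esymmValue a j) + t * r j) (newtonRoot a i m) -
        algebraMap k B (a i) ∧
      t ^ (m + 1) ∣ (vietaPoly fun j => algebraMap k B (esymmValue a j) + t * r j).eval
        (aeval (fun j => algebraMap k B (esymmValue a j) + t * r j) (newtonRoot a i m)) := by
  set s : Fin n → B := fun j => algebraMap k B (esymmValue a j) + t * r j with hs
  obtain ⟨q, hq⟩ := vietaPoly_add_mul (fun j => algebraMap k B (esymmValue a j)) r t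
  rw [← hs, ← map_vietaPoly] at hq
  induction m with
  | zero =>
    simp only [newtonRoot, aeval_C, sub_self, dvd_zero, zero_add, pow_one, true_and]
    rw [hq, Polynomial.eval_add, Polynomial.eval_map_algebraMap, Polynomial.aeval_algebraMap_apply,
      Polynomial.coe_aeval_eq_eval, eval_vietaPoly_esymmValue, map_zero, zero_add,
      Polynomial.eval_mul, Polynomial.eval_C]
    exact dvd_mul_right _ _
  | succ m ih =>
    rw [aeval_newtonRoot_succ]
    refine newton_step _ (by lia) ih.1 ?_ ih.2
    rw [hq, Polynomial.derivative_add, Polynomial.derivative_map, Polynomial.eval_add,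
      Polynomial.eval_map_algebraMap, Polynomial.aeval_algebraMap_apply,
      Polynomial.coe_aeval_eq_eval, mul_add, ← map_mul,
      inv_mul_cancel₀ (derivative_vietaPoly_esymmValue_ne_zero ha i), map_one, ← sub_sub, sub_self,
      zero_sub, dvd_neg, Polynomial.derivative_C_mul, Polynomial.eval_mul, Polynomial.eval_C]
    exact (dvd_mul_right _ _).mul_left _

/-- A symmetric polynomial, evaluated at approximate roots. -/
theorem dvd_aeval_newtonRoot_sub {a : Fin n → k} (ha : Function.Injective a) (t : B)
    (r : Fin n → B) (m : ℕ) (g : MvPolynomial (Fin n) k) :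
    t ^ (m + 1) ∣
      aeval (fun i => aeval (fun j => algebraMap k B (esymmValue a j) + t * r j)
          (newtonRoot a i m))
        (aeval (fun i : Fin n => esymm (Fin n) k ((i : ℕ) + 1)) g) -
      aeval (fun j => algebraMap k B (esymmValue a j) + t * r j) g := by
  have hroot := fun i => aeval_newtonRoot ha i t r m
  set s : Fin n → B := fun j => algebraMap k B (esymmValue a j) + t * r j
  set z : Fin n → B := fun i => aeval s (newtonRoot a i m)
  let Q := Ideal.Quotient.mkₐ k (Ideal.span {t ^ (m + 1)})
  -- In the quotient by t^(m+1) the z i are exact roots, and z i - z j is congruent to the nonzero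
  -- scalar a i - a j modulo t.
  have hunit : Pairwise fun i j => IsUnit (Q (z i) - Q (z j)) := by
    intro i j hij
    rw [← map_sub]
    refine isUnit_quotient_mk_of_dvd_sub (y := algebraMap k B (a i - a j)) _
      ((sub_ne_zero.2 (ha.ne hij)).isUnit.map _) ?_
    rw [map_sub, sub_sub_sub_comm]
    exact dvd_sub (hroot i).1 (hroot j).1
  have hzero : ∀ i, (vietaPoly fun j => Q (s j)).eval (Q (z i)) = 0 := by
    intro i
    have h := map_vietaPoly Q.toRingHom s
    have h' := Polynomial.eval_map_apply Q.toRingHom (z i) (p := vietaPoly s)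
    rw [h] at h'
    refine h'.trans ?_
    exact Ideal.Quotient.eq_zero_iff_dvd _ _ |>.2 (hroot i).2
  have hesymm := esymm_eq_of_roots (fun j => Q (s j)) (fun j => Q (z j)) hunit hzero
  rw [← Ideal.Quotient.eq_zero_iff_dvd, ← Ideal.Quotient.mkₐ_eq_mk k, map_sub, sub_eq_zero]
  change Q _ = Q _
  simp only [← AlgHom.comp_apply, comp_aeval]
  congr 1
  congr 1
  funext i
  rw [← hesymm i]
  exact aeval_esymm_eq_multiset_esymm (Fin n) k _ _

end newtonRoot

/-- Ensures that truncation after degree d loses nothing of g(s) when s is affine in t. -/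
theorem natDegree_aeval_le {k A σ : Type*} [CommRing k] [CommRing A] [Algebra k A]
    (s : σ → Polynomial A) (hs : ∀ i, (s i).natDegree ≤ 1) (g : MvPolynomial σ k) :
    (MvPolynomial.aeval s g).natDegree ≤ g.totalDegree := by
  rw [MvPolynomial.aeval_def, MvPolynomial.eval₂_eq]
  refine Polynomial.natDegree_sum_le_of_forall_le _ _ fun e he => ?_
  rw [IsScalarTower.algebraMap_apply k A (Polynomial A), Polynomial.algebraMap_eq]
  refine (Polynomial.natDegree_C_mul_le _ _).trans ((Polynomial.natDegree_prod_le _ _).trans ?_)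
  refine le_trans (Finset.sum_le_sum fun i _ => ?_) (MvPolynomial.le_totalDegree he)
  exact Polynomial.natDegree_pow_le.trans (by nlinarith [hs i])

/-! ### The relation between the e_i and the h_i -/

section

open MvPolynomial

variable (σ R : Type*) [Fintype σ] [DecidableEq σ] [CommRing R]

theorem coeff_hsymm (j : ℕ) (e : σ →₀ ℕ) :
    coeff e (hsymm σ R j) = if e.degree = j then 1 else 0 := by
  have h : ∀ s : Multiset σ, (s.map X).prod =
      (monomial (Multiset.toFinsupp s) 1 : MvPolynomial σ R) := by
    intro s
    induction s using Multiset.induction_on with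
    | empty => simp
    | cons a s ih =>
      rw [Multiset.map_cons, Multiset.prod_cons, ih, ← Multiset.singleton_add, map_add,
        Multiset.toFinsupp_singleton, X, monomial_mul, one_mul]
  unfold hsymm
  rw [coeff_sum]
  simp_rw [h, coeff_monomial]
  have hcard : ∀ s : Multiset σ, (Multiset.toFinsupp s).degree = Multiset.card s := by
    intro s
    exact Multiset.toFinsupp_sum_eq s
  split_ifs with he
  · have hc : Multiset.card (Finsupp.toMultiset e) = j := by
      rw [← hcard, Finsupp.toMultiset_toFinsupp, he]
    refine (Finset.sum_eq_single (⟨Finsupp.toMultiset e, hc⟩ : Sym σ j) ?_ ?_).trans ?_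
    · intro s _ hs
      rw [if_neg]
      rintro rfl
      exact hs (Subtype.ext (by simp))
    · exact fun h => absurd (Finset.mem_univ (α := Sym σ j) _) h
    · simp
  · refine Finset.sum_eq_zero fun s _ => if_neg ?_
    rintro rfl
    exact he (by rw [hcard]; exact s.2)

/-- The relation between elementary and complete homogeneous symmetric polynomials. -/
theorem sum_neg_one_pow_mul_esymm_mul_hsymm {m : ℕ} (hm : 0 < m) :
    ∑ i ∈ Finset.range (m + 1), (-1) ^ i * esymm σ R i * hsymm σ R (m - i) = 0 := by
  ext e
  rw [coeff_zero, coeff_sum]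
  have hprod : ∀ t : Finset σ, (∏ i ∈ t, X i : MvPolynomial σ R) =
      monomial (∑ i ∈ t, Finsupp.single i 1) 1 := by
    intro t
    rw [monomial_sum_one]
    rfl
  have hle : ∀ t : Finset σ, (∑ i ∈ t, Finsupp.single i 1 ≤ e) ↔ t ⊆ e.support := by
    intro t
    constructor
    · intro h i hi
      have := h i
      rw [Finsupp.finsetSum_apply, Finset.sum_eq_single i] at this
      · rw [Finsupp.mem_support_iff]
        simp at this
        lia
      · intro j _ hj
        simp [hj]
      · exact fun h => absurd hi h
    · intro h i
      rw [Finsupp.finsetSum_apply]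
      by_cases hi : i ∈ t
      · rw [Finset.sum_eq_single i]
        · have := Finsupp.mem_support_iff.1 (h hi)
          simp
          lia
        · intro j _ hj
          simp [hj]
        · exact fun h => absurd hi h
      · rw [Finset.sum_eq_zero]
        · lia
        · intro j hj
          rw [Finsupp.single_apply, if_neg]
          rintro rfl
          exact hi hj
  have hdeg : ∀ t : Finset σ, (∑ i ∈ t, Finsupp.single i 1 : σ →₀ ℕ).degree = t.card := by
    intro t
    simp [map_sum]
  -- The monomial e splits into a squarefree part from `esymm`, given by a set t inside its support,
  -- and a remainder that `hsymm` contains with coefficient 1 when the degrees match.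
  have hterm : ∀ i ∈ Finset.range (m + 1),
      coeff e ((-1) ^ i * esymm σ R i * hsymm σ R (m - i)) =
        ∑ t ∈ Finset.powersetCard i e.support, (-1) ^ t.card * if e.degree = m then 1 else 0 := by
    intro i hi
    rw [esymm, mul_assoc, Finset.sum_mul, ← C_1, ← C_neg, ← C_pow, coeff_C_mul, coeff_sum,
      Finset.mul_sum]
    symm
    refine Finset.sum_subset_zero_on_sdiff
      (Finset.powersetCard_mono (Finset.subset_univ e.support)) ?_ ?_
    · intro t ht
      rw [Finset.mem_sdiff, Finset.mem_powersetCard, Finset.mem_powersetCard] at ht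
      rw [hprod, coeff_monomial_mul', if_neg, mul_zero]
      rw [hle]
      exact fun h => ht.2 ⟨h, ht.1.2⟩
    · intro t ht
      rw [Finset.mem_powersetCard] at ht
      have h := (hle t).2 ht.1
      rw [hprod, coeff_monomial_mul', if_pos h, coeff_hsymm, ht.2, one_mul]
      congr 1
      have h₁ : e.degree = (e - ∑ i ∈ t, Finsupp.single i 1).degree + i := by
        rw [← ht.2, ← hdeg t, ← map_add, tsub_add_cancel_of_le h]
      rw [Finset.mem_range] at hi
      refine if_congr ?_ rfl rfl
      lia
  rw [Finset.sum_congr rfl hterm]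
  by_cases he : e.degree = m
  -- Since m > 0 the support is nonempty, so the signed count of its subsets vanishes; sizes between
  -- the cardinality of the support and m contribute nothing.
  · have hne : e.support.Nonempty := by
      rw [Finsupp.support_nonempty_iff]
      rintro rfl
      simp at he
      lia
    have hcard : e.support.card ≤ m := by
      rw [← he, Finsupp.degree, Finset.card_eq_sum_ones]
      exact Finset.sum_le_sum fun i hi => by
        have := Finsupp.mem_support_iff.1 hi
        lia
    simp only [he, if_true, mul_one]
    have h := congrArg (Int.cast : ℤ → R) (Finset.sum_powerset_neg_one_pow_card_of_nonempty hne)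
    push_cast at h
    rw [Finset.sum_powerset, Finset.sum_subset (Finset.range_subset_range.2 (Nat.succ_le_succ hcard))] at h
    · exact h
    · intro i _ hi
      rw [Finset.powersetCard_eq_empty.2 (by simpa using hi)]
      simp
  · simp [he]

end

/-! ### Free generators of the symmetric polynomials -/

/-- The kernels of the powers of φ stabilise, say at m. If φ x = 0 and x = φ^m y, then y lies in ker
φ^(m+1) = ker φ^m, so x = 0. -/
theorem RingHom.injective_of_surjective_of_isNoetherianRing {A : Type*} [CommRing A]
    [IsNoetherianRing A] (φ : A →+* A) (h : Function.Surjective φ) : Function.Injective φ := by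
  have hmono : Monotone fun m => RingHom.ker (φ ^ m) := monotone_nat_of_le_succ fun m x hx => by
    rw [RingHom.mem_ker] at hx ⊢
    rw [pow_succ', RingHom.mul_def, RingHom.comp_apply, hx, map_zero]
  obtain ⟨m, hm⟩ := monotone_stabilizes_iff_noetherian.2 ‹IsNoetherianRing A›
    ⟨fun m => RingHom.ker (φ ^ m), hmono⟩
  rw [injective_iff_map_eq_zero]
  intro x hx
  obtain ⟨y, rfl⟩ : ∃ y, (φ ^ m) y = x := by
    rw [RingHom.coe_pow]
    exact h.iterate m x
  have hy : y ∈ RingHom.ker (φ ^ (m + 1)) := by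
    rw [RingHom.mem_ker, pow_succ', RingHom.mul_def, RingHom.comp_apply, hx]
  have := hm (m + 1) (by lia)
  simp only [OrderHom.coe_mk] at this
  rw [← this] at hy
  exact hy

section symmetricGenerators

open MvPolynomial

/-- If the `esymm i` are the polynomials `E i` in the symmetric polynomials `g i`, then the
`g i` generate the symmetric polynomials freely. -/
theorem eq_aeval_iff_of_esymm_eq {R : Type*} [CommRing R] [IsNoetherianRing R] {n : ℕ}
    {g E : Fin n → MvPolynomial (Fin n) R} (hg : ∀ i, (g i).IsSymmetric)
    (hE : ∀ i : Fin n, esymm (Fin n) R ((i : ℕ) + 1) = aeval g (E i))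
    (p q : MvPolynomial (Fin n) R) :
    aeval (fun i : Fin n => esymm (Fin n) R ((i : ℕ) + 1)) p = aeval g q ↔ q = aeval E p := by
  set φ : MvPolynomial (Fin n) R →ₐ[R] MvPolynomial (Fin n) R :=
    aeval (fun i : Fin n => esymm (Fin n) R ((i : ℕ) + 1))
  have hφ : Function.Injective φ := by
    intro x y hxy
    refine esymmAlgHom_fin_injective R le_rfl (Subtype.ext ?_)
    rw [esymmAlgHom_apply, esymmAlgHom_apply]
    exact hxy
  have hsurj : ∀ i, ∃ x, φ x = g i := by
    intro i
    obtain ⟨x, hx⟩ := (esymmAlgHom_fin_bijective R n).2 ⟨g i, hg i⟩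
    refine ⟨x, ?_⟩
    have := congrArg Subtype.val hx
    rwa [esymmAlgHom_apply] at this
  choose G hG using hsurj
  have h₁ : φ.comp (aeval G) = aeval g := algHom_ext fun i => by simp [hG]
  have h₂ : (aeval g).comp (aeval E) = φ := algHom_ext fun i => by simp [φ, hE]
  -- Here g i = G i(e), so substituting G into E returns the variables. Thus `aeval G` is
  -- surjective, hence injective, and so is `aeval g`, its composite with φ.
  have h₃ : ∀ x, aeval G (aeval E x) = x := by
    intro x
    apply hφ
    rw [← AlgHom.comp_apply φ, h₁, ← AlgHom.comp_apply, h₂]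
  have hG : Function.Injective (aeval G : MvPolynomial (Fin n) R →ₐ[R] MvPolynomial (Fin n) R) :=
    RingHom.injective_of_surjective_of_isNoetherianRing
      (aeval G : MvPolynomial (Fin n) R →ₐ[R] MvPolynomial (Fin n) R).toRingHom
      fun x => ⟨aeval E x, h₃ x⟩
  have hginj : Function.Injective
      (aeval g : MvPolynomial (Fin n) R →ₐ[R] MvPolynomial (Fin n) R) := by
    rw [← h₁]
    exact hφ.comp hG
  rw [← h₂, AlgHom.comp_apply, hginj.eq_iff, eq_comm]

/-- The polynomials in the variables `X 0, X 1, …` defined by a linear recursion of the type of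
Newton's identities. -/
noncomputable def newtonRec {R : Type*} [CommRing R] {n : ℕ} (c : ℕ → ℕ → R) :
    ℕ → MvPolynomial (Fin n) R
  | 0 => 1
  | m + 1 => ∑ j : Fin (m + 1), C (c m j) *
      -- The variable of index m - j stands for the generator of degree m - j + 1; the default 0
      -- does not occur while m + 1 ≤ n.
      (newtonRec c (j : ℕ) * if h : m - (j : ℕ) < n then X ⟨m - (j : ℕ), h⟩ else 0)

theorem esymm_eq_aeval_newtonRec {R : Type*} [CommRing R] {n : ℕ} (c : ℕ → ℕ → R)
    (g : ℕ → MvPolynomial (Fin n) R)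
    (h : ∀ m, esymm (Fin n) R (m + 1) =
      ∑ j ∈ Finset.range (m + 1), C (c m j) * (esymm (Fin n) R j * g (m - j)))
    (m : ℕ) (hm : m ≤ n) :
    esymm (Fin n) R m = aeval (fun i : Fin n => g i) (newtonRec c m) := by
  induction m using Nat.strong_induction_on with
  | _ m ih =>
    cases m with
    | zero => simp [newtonRec]
    | succ m =>
      rw [h, newtonRec, Finset.sum_range, map_sum]
      refine Finset.sum_congr rfl fun j _ => ?_
      rw [ih j (by lia) (by lia), dif_pos (by lia)]
      simp [algebraMap_eq]

theorem esymm_succ_eq_sum_hsymm {R : Type*} [CommRing R] (n m : ℕ) :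
    esymm (Fin n) R (m + 1) = ∑ j ∈ Finset.range (m + 1),
      C ((-1) ^ (m + j)) * (esymm (Fin n) R j * hsymm (Fin n) R (m - j + 1)) := by
  have h := sum_neg_one_pow_mul_esymm_mul_hsymm (Fin n) R (Nat.succ_pos m)
  rw [Finset.sum_range_succ, Nat.succ_eq_add_one, Nat.sub_self, hsymm_zero, mul_one] at h
  have h' := congrArg (fun x => (-1) ^ m * x) h
  simp only [mul_add, mul_zero, ← mul_assoc, ← pow_add] at h'
  rw [Odd.neg_one_pow (n := m + (m + 1)) ⟨m, by ring⟩, neg_one_mul, add_neg_eq_zero, Finset.mul_sum] at h'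
  rw [← h']
  refine Finset.sum_congr rfl fun j hj => ?_
  rw [show m + 1 - j = m - j + 1 by have := Finset.mem_range.1 hj; lia, pow_add]
  simp
  ring

/-- Newton's identity divided by m + 1, which requires characteristic zero. -/
theorem esymm_succ_eq_sum_psum {k : Type*} [Field k] [CharZero k] (n m : ℕ) :
    esymm (Fin n) k (m + 1) = ∑ j ∈ Finset.range (m + 1),
      C ((-1) ^ (m + j) / ((m : k) + 1)) * (esymm (Fin n) k j * psum (Fin n) k (m - j + 1)) := by
  have h := mul_esymm_eq_sum (Fin n) k (m + 1)
  have hs : ∑ a ∈ Finset.HasAntidiagonal.antidiagonal (m + 1) with a.1 < m + 1,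
      (-1) ^ a.1 * esymm (Fin n) k a.1 * psum (Fin n) k a.2 =
      ∑ j ∈ Finset.range (m + 1), (-1) ^ j * esymm (Fin n) k j * psum (Fin n) k (m - j + 1) := by
    rw [Finset.sum_filter, Finset.Nat.sum_antidiagonal_eq_sum_range_succ_mk,
      Finset.sum_range_succ, if_neg (by simp), add_zero]
    refine Finset.sum_congr rfl fun j hj => ?_
    have := Finset.mem_range.1 hj
    rw [if_pos this, show m + 1 - j = m - j + 1 by lia]
  rw [hs] at h
  have hne : (m : k) + 1 ≠ 0 := Nat.cast_add_one_ne_zero m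
  have h' := congrArg (fun x => C ((m : k) + 1)⁻¹ * x) h
  rw [← mul_assoc, show ((m + 1 : ℕ) : MvPolynomial (Fin n) k) = C ((m : k) + 1) by simp, ← C_mul,
    inv_mul_cancel₀ hne, C_1, one_mul] at h'
  rw [h', Finset.mul_sum, Finset.mul_sum]
  refine Finset.sum_congr rfl fun j _ => ?_
  rw [div_eq_mul_inv, C_mul, C_pow, C_neg, C_1]
  ring

end symmetricGenerators

/-! ### Circuit sizes -/

section cost

open MvPolynomial

theorem derives_range_X {k : Type*} [CommSemiring k] {n : ℕ} (S : Set (MvPolynomial (Fin n) k)) :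
    Derives S (Set.range (X : Fin n → MvPolynomial (Fin n) k)) n := by
  simpa using Derives.range (S := S) (X : Fin n → MvPolynomial (Fin n) k) fun i => Derives.X S i

theorem derives_newtonRec {k : Type*} [CommRing k] {n : ℕ} (c : ℕ → ℕ → k) :
    Derives ∅ (Set.range fun i : Fin n => newtonRec (n := n) c ((i : ℕ) + 1))
      (5 * (n + 1) ^ 2) := by
  have h : ∀ m ≤ n, Derives (Set.range (X : Fin n → MvPolynomial (Fin n) k))
      (newtonRec c '' Set.Iic m) (1 + m * (4 * n + 1)) := by
    intro m
    induction m with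
    | zero =>
      intro _
      have : newtonRec (n := n) c '' Set.Iic 0 = {C 1} := by
        rw [show Set.Iic 0 = {0} by ext; simp, Set.image_singleton, newtonRec, C_1]
      rw [this]
      exact (Derives.C _ 1).mono subset_rfl subset_rfl (by lia)
    | succ m ih =>
      intro hm
      have h' := Derives.finset_sum_mul
        (S := Set.range (X : Fin n → MvPolynomial (Fin n) k) ∪ newtonRec c '' Set.Iic m)
        Finset.univ (fun j : Fin (m + 1) => c m j) (fun j => newtonRec c (j : ℕ))
        (fun j => if h : m - (j : ℕ) < n then X ⟨m - (j : ℕ), h⟩ else 0)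
        (fun j _ => Or.inr ⟨j, by simp; lia, rfl⟩)
        (fun j _ => Or.inl ⟨⟨m - (j : ℕ), by lia⟩, by rw [dif_pos]⟩)
      refine ((ih (by lia)).trans h').mono subset_rfl ?_ (by simp; nlinarith)
      rintro _ ⟨j, hj, rfl⟩
      rcases Nat.le_succ_iff.1 (Set.mem_Iic.1 hj) with hj | rfl
      · exact Or.inl ⟨j, hj, rfl⟩
      · right
        rw [Set.mem_singleton_iff, newtonRec]
  refine ((derives_range_X ∅).trans ((h n le_rfl).mono Set.subset_union_right subset_rfl
    le_rfl)).mono subset_rfl ?_ (by nlinarith)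
  rintro _ ⟨i, rfl⟩
  exact Or.inr ⟨(i : ℕ) + 1, i.2, rfl⟩

/-- Puts a Newton step in the form of a single sum node over n + 1 product nodes and z itself. -/
theorem sub_mul_eval_vietaPoly_X {k : Type*} [CommRing k] {n : ℕ} (z : MvPolynomial (Fin n) k)
    (u : k) :
    z - C u * (vietaPoly (X : Fin n → MvPolynomial (Fin n) k)).eval z =
      (((1, z) :: (-u, z ^ n) :: (List.finRange n).map fun j : Fin n =>
        (-u * (-1) ^ ((j : ℕ) + 1), X j * z ^ (n - ((j : ℕ) + 1)))).map
          fun p => C p.1 * p.2).sum := by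
  rw [eval_vietaPoly, List.map_cons, List.map_cons, List.sum_cons, List.sum_cons, List.map_map,
    ← List.ofFn_eq_map, List.sum_ofFn, mul_add, Finset.mul_sum, C_1, one_mul, C_neg, neg_mul,
    sub_eq_add_neg, neg_add, ← Finset.sum_neg_distrib]
  congr 2
  refine Finset.sum_congr rfl fun j _ => ?_
  simp only [Function.comp_apply, map_neg, map_mul, map_pow, map_one]
  ring

theorem derives_newtonRoot {k : Type*} [Field k] {n : ℕ} (a : Fin n → k) (m : ℕ) :
    Derives ∅ (Set.range fun i => newtonRoot a i m) (4 * (n + 1) ^ 3 * (m + 1)) := by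
  have hstep : ∀ m i, Derives (Set.range (X : Fin n → MvPolynomial (Fin n) k) ∪
      Set.range fun i => newtonRoot a i m) {newtonRoot a i (m + 1)} (4 * (n + 1) ^ 2) := by
    intro m i
    set z := newtonRoot a i m with hz
    set S := Set.range (X : Fin n → MvPolynomial (Fin n) k) ∪
      Set.range fun i => newtonRoot a i m with hS
    have hzS : z ∈ S := Or.inr ⟨i, rfl⟩
    have h₁ : Derives S {z ^ n} (n + 1) := by
      have := Derives.prod (S := S) (List.replicate n z) (by
        intro p hp
        rwa [List.eq_of_mem_replicate hp])
      simpa [add_comm] using this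
    have h₂ : Derives S (Set.range fun j : Fin n => X j * z ^ (n - ((j : ℕ) + 1)))
        (n * (n + 1)) := by
      have := Derives.range (S := S) (c := n + 1)
        (fun j : Fin n => X j * z ^ (n - ((j : ℕ) + 1))) fun j => by
          have := Derives.prod (S := S) (X j :: List.replicate (n - ((j : ℕ) + 1)) z) (by
            intro p hp
            rcases List.mem_cons.1 hp with rfl | hp
            · exact Or.inl ⟨j, rfl⟩
            · rwa [List.eq_of_mem_replicate hp])
          refine this.mono subset_rfl (by simp) ?_
          simp only [List.length_cons, List.length_replicate]
          lia
      simpa using this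
    set u := ((vietaPoly (esymmValue a)).derivative.eval (a i))⁻¹ with hu
    have h₃ := Derives.sum
      (S := S ∪ ({z ^ n} ∪ Set.range fun j : Fin n => X j * z ^ (n - ((j : ℕ) + 1))))
      ((1, z) :: (-u, z ^ n) :: (List.finRange n).map fun j : Fin n =>
        (-u * (-1) ^ ((j : ℕ) + 1), X j * z ^ (n - ((j : ℕ) + 1)))) (by
        intro p hp
        simp only [List.mem_cons, List.mem_map, List.mem_finRange, true_and] at hp
        rcases hp with rfl | rfl | ⟨j, rfl⟩
        · exact Or.inl hzS
        · exact Or.inr (Or.inl rfl)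
        · exact Or.inr (Or.inr ⟨j, rfl⟩))
    refine ((h₁.union h₂).trans h₃).mono subset_rfl ?_ (by
      simp only [List.length_cons, List.length_map, List.length_finRange]
      nlinarith)
    refine (Set.singleton_subset_iff.2 ?_).trans Set.subset_union_right
    exact sub_mul_eval_vietaPoly_X z u
  have h : Derives (Set.range (X : Fin n → MvPolynomial (Fin n) k))
      (Set.range fun i => newtonRoot a i m) (n + m * (4 * (n + 1) ^ 3)) := by
    induction m with
    | zero =>
      have := Derives.range (S := Set.range (X : Fin n → MvPolynomial (Fin n) k))
        (fun i => newtonRoot a i 0) fun i => Derives.C _ (a i)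
      simpa using this
    | succ m ih =>
      have := Derives.range (fun i => newtonRoot a i (m + 1)) (hstep m)
      refine (ih.trans this).mono subset_rfl Set.subset_union_right ?_
      have hn : n * (4 * (n + 1) ^ 2) ≤ 4 * (n + 1) ^ 3 :=
        calc n * (4 * (n + 1) ^ 2) ≤ (n + 1) * (4 * (n + 1) ^ 2) := by gcongr; lia
          _ = 4 * (n + 1) ^ 3 := by ring
      rw [Fintype.card_fin, add_mul, add_assoc, one_mul]
      gcongr
  refine ((derives_range_X ∅).trans (h.mono Set.subset_union_right subset_rfl le_rfl)).mono
    subset_rfl Set.subset_union_right ?_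
  nlinarith [Nat.le_self_pow three_ne_zero (n + 1)]

/-- A polynomial in the elementary symmetric polynomials, evaluated at other arguments. -/
theorem circuitSize_aeval_le {k : Type*} [Field k] [CharZero k] {n c : ℕ}
    {w : Fin n → MvPolynomial (Fin n) k} (hw : Derives ∅ (Set.range w) c)
    (g : MvPolynomial (Fin n) k) :
    circuitSize (aeval w g) ≤ 20 * g.totalDegree ^ 2 *
      circuitSize (aeval (fun i : Fin n => esymm (Fin n) k ((i : ℕ) + 1)) g) +
        (c + 26 * (n + g.totalDegree + 1) ^ 6) := by
  set d := g.totalDegree with hd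
  set f := aeval (fun i : Fin n => esymm (Fin n) k ((i : ℕ) + 1)) g with hf
  have hN : 1 ≤ (n + d + 1) ^ 6 := Nat.one_le_pow _ _ (by lia)
  rcases Nat.eq_zero_or_pos d with h0 | hpos
  -- For d = 0 the term in d² vanishes and cannot absorb (d + 1)², but then g is constant.
  · have hC : aeval w g = C (coeff 0 g) := by
      rw [totalDegree_eq_zero_iff_eq_C.1 (hd.symm.trans h0)]
      simp [algebraMap_eq]
    have := (Derives.C ∅ (coeff 0 g) : Derives (σ := Fin n) _ _ _).circuitSize_le
    rw [hC]
    lia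
  let a : Fin n → k := fun i => ((i : ℕ) : k)
  have ha : Function.Injective a := fun i j hij => Fin.ext (Nat.cast_injective hij)
  -- The polynomial variable plays the role of t: s is the line from e(a) at t = 0 to w at t = 1.
  let r : Fin n → Polynomial (MvPolynomial (Fin n) k) :=
    fun j => Polynomial.C (w j - C (esymmValue a j))
  let s : Fin n → Polynomial (MvPolynomial (Fin n) k) :=
    fun j => algebraMap k _ (esymmValue a j) + Polynomial.X * r j
  have hs : ∀ j, s j = Polynomial.C (C (esymmValue a j)) +
      Polynomial.X * Polynomial.C (w j - C (esymmValue a j)) := fun j => rfl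
  have hsd : ∀ j, (s j).natDegree ≤ 1 := by
    intro j
    rw [hs]
    refine (Polynomial.natDegree_add_le _ _).trans (max_le (by simp) ?_)
    refine Polynomial.natDegree_mul_le.trans ?_
    rw [Polynomial.natDegree_C]
    exact Polynomial.natDegree_X_le
  have hcong := dvd_aeval_newtonRoot_sub ha Polynomial.X r d g
  change Polynomial.X ^ (d + 1) ∣ aeval (fun i => aeval s (newtonRoot a i d)) f - aeval s g
    at hcong
  -- Evaluate g(s) at t = 1; its coefficients up to degree d are those of f(z), and it has no
  -- others.
  have heq : aeval w g = ∑ j ∈ Finset.range (d + 1),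
      C 1 * (aeval (fun i => aeval s (newtonRoot a i d)) f).coeff j := by
    have h₁ : (aeval s g).eval 1 = aeval w g := by
      have : ((Polynomial.aeval (1 : MvPolynomial (Fin n) k)).restrictScalars k).comp (aeval s) =
          aeval w := algHom_ext fun j => by simp [hs]
      rw [← this, AlgHom.comp_apply, AlgHom.restrictScalars_apply, Polynomial.coe_aeval_eq_eval]
    rw [← h₁, Polynomial.eval_eq_sum_range'
      (Nat.lt_succ_of_le (natDegree_aeval_le s hsd g))]
    refine Finset.sum_congr rfl fun j hj => ?_
    have := Polynomial.X_pow_dvd_iff.1 hcong j (Finset.mem_range.1 hj)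
    rw [Polynomial.coeff_sub, sub_eq_zero] at this
    simp [this]
  obtain ⟨m₁, D₁, hD₁, hD₁size⟩ := (derives_newtonRoot a d).exists_circuit
  obtain ⟨m₂, D₂, r₂, hD₂, hD₂size⟩ := exists_circuit_size_eq_circuitSize f
  have hcoeff : Derives (Set.range w) (⋃ j, coeffSet d (s j)) (n * ((d + 1) * 4)) := by
    have := Derives.iUnion (S := Set.range w) (fun j => coeffSet d (s j))
      (c := (d + 1) * 4) fun j => Derives.coeffSet_of_coeff fun i _ => by
        rw [hs]
        rcases i with _ | _ | i
        · simpa using (Derives.C _ (esymmValue a j)).mono subset_rfl subset_rfl (by lia)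
        · have h := Derives.sum (S := Set.range w ∪ {C (esymmValue a j)})
            [(1, w j), (-1, C (esymmValue a j))] (by simp)
          refine ((Derives.C _ (esymmValue a j)).trans h).mono subset_rfl ?_ (by simp)
          refine (Set.singleton_subset_iff.2 ?_).trans Set.subset_union_right
          simp [Polynomial.coeff_C, sub_eq_add_neg]
        · refine (Derives.C _ 0).mono subset_rfl ?_ (by lia : 1 ≤ 4)
          simp [Polynomial.coeff_X_mul]
    simpa using this
  have hroots := Derives.coeffSet_circuit (S := Set.range w ∪ ⋃ j, coeffSet d (s j)) (d := d) s
    (fun j => (Set.subset_iUnion (fun j => coeffSet d (s j)) j).trans Set.subset_union_right) D₁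
  have hroots' : Derives (Set.range w ∪ ⋃ j, coeffSet d (s j))
      (⋃ i, coeffSet d (aeval s (newtonRoot a i d)))
      (5 * (d + 1) ^ 2 * (4 * (n + 1) ^ 3 * (d + 1))) := by
    refine hroots.mono subset_rfl (Set.iUnion_subset fun i => ?_) (by gcongr)
    obtain ⟨q, hq⟩ := hD₁ ⟨i, rfl⟩
    change coeffSet d (aeval s ((fun i => newtonRoot a i d) i)) ⊆ _
    rw [← hq]
    exact Set.subset_iUnion (fun q => coeffSet d (aeval s (D₁.value q))) q
  have hsymm := Derives.coeffSet_circuit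
    (S := ⋃ i, coeffSet d (aeval s (newtonRoot a i d))) (d := d)
    (fun i => aeval s (newtonRoot a i d))
    (fun i => Set.subset_iUnion (fun i => coeffSet d (aeval s (newtonRoot a i d))) i) D₂
  have hsymm' : Derives (⋃ i, coeffSet d (aeval s (newtonRoot a i d)))
      (coeffSet d (aeval (fun i => aeval s (newtonRoot a i d)) f))
      (5 * (d + 1) ^ 2 * circuitSize f) := by
    refine hsymm.mono subset_rfl ?_ (by rw [hD₂size])
    rw [← hD₂]
    exact Set.subset_iUnion (fun q => coeffSet d (aeval (fun i => aeval s (newtonRoot a i d))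
      (D₂.value q))) r₂
  have hfinal : Derives (coeffSet d (aeval (fun i => aeval s (newtonRoot a i d)) f))
      {aeval w g} (1 + (d + 1)) := by
    have := Derives.finset_sum (S := coeffSet d (aeval (fun i => aeval s (newtonRoot a i d)) f))
      (Finset.range (d + 1)) (fun _ => 1)
      (fun j => (aeval (fun i => aeval s (newtonRoot a i d)) f).coeff j)
      (fun j hj => coeff_mem_coeffSet _ (Nat.lt_succ_iff.1 (Finset.mem_range.1 hj)))
    rw [← heq, Finset.card_range] at this
    exact this
  have htotal := hw.trans ((hcoeff.trans (hroots'.trans (((hsymm'.mono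
    Set.subset_union_right subset_rfl le_rfl).trans (hfinal.mono
      Set.subset_union_right subset_rfl le_rfl))))).mono
        (Set.subset_union_right (s := ∅)) subset_rfl le_rfl)
  refine (htotal.mono subset_rfl ?_ le_rfl).circuitSize_le.trans ?_
  · exact fun x hx => by simp only [Set.mem_union]; tauto
  · set N := n + d + 1 with hNdef
    have hNpow : ∀ i ≤ 6, N ^ i ≤ N ^ 6 := fun i hi => Nat.pow_le_pow_right (by lia) hi
    have e₁ : n * ((d + 1) * 4) ≤ 4 * N ^ 6 :=
      calc n * ((d + 1) * 4) ≤ N * (N * 4) := by gcongr <;> lia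
        _ = 4 * N ^ 2 := by ring
        _ ≤ 4 * N ^ 6 := Nat.mul_le_mul_left 4 (hNpow 2 (by lia))
    have e₂ : 5 * (d + 1) ^ 2 * (4 * (n + 1) ^ 3 * (d + 1)) ≤ 20 * N ^ 6 :=
      calc 5 * (d + 1) ^ 2 * (4 * (n + 1) ^ 3 * (d + 1)) ≤ 5 * N ^ 2 * (4 * N ^ 3 * N) := by
            gcongr <;> lia
        _ = 20 * N ^ 6 := by ring
    -- Since d ≥ 1, d + 1 ≤ 2d; this is the origin of the constant 20.
    have e₃ : 5 * (d + 1) ^ 2 * circuitSize f ≤ 20 * d ^ 2 * circuitSize f := by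
      refine Nat.mul_le_mul_right _ ?_
      nlinarith
    have e₄ : 1 + (d + 1) ≤ 2 * N ^ 6 := by
      have := hNpow 1 (by lia)
      rw [pow_one] at this
      lia
    lia

/-- One constant must serve as both factor and exponent; 31 = 5 + 26 does. -/
theorem five_mul_sq_add_le {M N : ℕ} (hM : 1 ≤ M) (hMN : M ≤ N) :
    5 * M ^ 2 + 26 * N ^ 6 ≤ 31 * N ^ 31 := by
  have h₁ : M ^ 2 ≤ N ^ 31 :=
    (pow_le_pow_left₀ (Nat.zero_le M) hMN 2).trans
      (pow_le_pow_right₀ (hM.trans hMN) (by norm_num))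
  have h₂ : N ^ 6 ≤ N ^ 31 := pow_le_pow_right₀ (hM.trans hMN) (by norm_num)
  generalize N ^ 31 = x at *
  lia

end cost

/-! ### The theorem -/

theorem theorem4p13 :
    ∃ K c : ℕ, ∀ (n : ℕ) (f : MvPolynomial (Fin n) ℂ), f.IsSymmetric →
      ∃ fE fH fP : MvPolynomial (Fin n) ℂ,
        (∀ g : MvPolynomial (Fin n) ℂ,
          f = MvPolynomial.aeval
            (fun i : Fin n => MvPolynomial.esymm (Fin n) ℂ ((i : ℕ) + 1)) g ↔ g = fE) ∧
        (∀ g : MvPolynomial (Fin n) ℂ,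
          f = MvPolynomial.aeval
            (fun i : Fin n => MvPolynomial.hsymm (Fin n) ℂ ((i : ℕ) + 1)) g ↔ g = fH) ∧
        (∀ g : MvPolynomial (Fin n) ℂ,
          f = MvPolynomial.aeval
            (fun i : Fin n => MvPolynomial.psum (Fin n) ℂ ((i : ℕ) + 1)) g ↔ g = fP) ∧
        circuitSize fE ≤
          K * fE.totalDegree ^ 2 * circuitSize f + c * (n + fE.totalDegree + 1) ^ c ∧
        circuitSize fH ≤
          K * fE.totalDegree ^ 2 * circuitSize f + c * (n + fE.totalDegree + 1) ^ c ∧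
        circuitSize fP ≤
          K * fE.totalDegree ^ 2 * circuitSize f + c * (n + fE.totalDegree + 1) ^ c := by
  refine ⟨20, 31, fun n f hf => ?_⟩
  obtain ⟨fE, hfE⟩ := (MvPolynomial.esymmAlgHom_fin_bijective ℂ n).2 ⟨f, hf⟩
  replace hfE := congrArg Subtype.val hfE
  rw [MvPolynomial.esymmAlgHom_apply] at hfE
  change _ = f at hfE
  subst hfE
  have key : ∀ w : Fin n → MvPolynomial (Fin n) ℂ,
      Derives ∅ (Set.range w) (5 * (n + 1) ^ 2) →
        circuitSize (MvPolynomial.aeval w fE) ≤ 20 * fE.totalDegree ^ 2 *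
          circuitSize (MvPolynomial.aeval
            (fun i : Fin n => MvPolynomial.esymm (Fin n) ℂ ((i : ℕ) + 1)) fE) +
          31 * (n + fE.totalDegree + 1) ^ 31 := by
    intro w hw
    refine (circuitSize_aeval_le hw fE).trans (Nat.add_le_add_left ?_ _)
    exact five_mul_sq_add_le (by lia) (by lia)
  have keyX := key MvPolynomial.X ((derives_range_X ∅).mono subset_rfl subset_rfl (by
    nlinarith only [Nat.zero_le n]))
  rw [MvPolynomial.aeval_X_left_apply] at keyX
  -- The witnesses left open are `aeval E fE`, with E the two instances of `newtonRec`; hence all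
  -- three bounds involve only the degree of `fE`.
  refine ⟨fE, _, _, ?_,
    eq_aeval_iff_of_esymm_eq (fun i => MvPolynomial.hsymm_isSymmetric _ _ _)
      (fun i => esymm_eq_aeval_newtonRec _ (fun m => MvPolynomial.hsymm (Fin n) ℂ (m + 1))
        (esymm_succ_eq_sum_hsymm n) _ i.2) fE,
    eq_aeval_iff_of_esymm_eq (fun i => MvPolynomial.psum_isSymmetric _ _ _)
      (fun i => esymm_eq_aeval_newtonRec _ (fun m => MvPolynomial.psum (Fin n) ℂ (m + 1))
        (esymm_succ_eq_sum_psum n) _ i.2) fE,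
    keyX, key _ (derives_newtonRec _), key _ (derives_newtonRec _)⟩
  intro g
  -- Uniqueness of `fE` is the case where the generators are the e_i themselves.
  have := eq_aeval_iff_of_esymm_eq (E := MvPolynomial.X)
    (fun i : Fin n => MvPolynomial.esymm_isSymmetric (Fin n) ℂ ((i : ℕ) + 1))
    (fun i => by simp) fE g
  rwa [MvPolynomial.aeval_X_left_apply] at this
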